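/- **Setting.** On $L^2(\mathbb R)$ let $\hat x$ be multiplication by $x$ and $\hat p=-i\,d/dx$, let $|0\rangle$ be the ground state $\pi^{-1/4}e^{-x^2/2}$ of the harmonic oscillator, and for $\alpha,\beta\in\mathbb R$ let $$D(\alpha,\beta)=\exp\bigl(i\sqrt2\,\beta\hat x-i\sqrt2\,\alpha\hat p\bigr),\qquad |\alpha,\beta\rangle=D(\alpha,\beta)|0\rangle ,$$ that is, $(D(\alpha,\beta)\psi)(x)=e^{i\sqrt2\beta x-i\alpha\beta}\,\psi(x-\sqrt2\alpha)$. For $\sin\theta\neq0$ let $$\Delta(x,y;\theta)=\Bigl[\frac{1+i\cot\theta}{2\pi}\Bigr]^{1/2}\exp\Bigl[-\frac{i(x^2+y^2)\cot\theta}{2}+\frac{ixy}{\sin\theta}\Bigr]$$ (principal square root), and let $\Delta(x,y;\theta)=\delta(y-x\cos\theta)$ if $\sin\theta=0$. For real $\theta_1,\theta_2$ with $\cos(\theta_1-\theta_2)\ne0$ let $$U(\alpha,\beta;\theta_1,\theta_2)=|\cos(\theta_1-\theta_2)|^{1/2}\int d\alpha'\,d\beta'\;\Delta(\beta,\alpha';\theta_2)\,\Delta(\alpha,-\beta';\theta_1)\,D(\alpha',\beta'),$$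 where the integral is understood weakly, as an absolutely convergent integral of matrix elements between Schwartz functions. The bifractional and the R-bifractional coherent states are $$|\alpha,\beta;\theta_1,\theta_2\rangle=U(\alpha,\beta;\theta_1,\theta_2)|0\rangle,\qquad |\alpha,\beta;\theta_1,\theta_2\rangle_R=U(0,0;\theta_1,\theta_2)|\alpha,\beta\rangle .$$ **Proposition.** Let $\theta_1,\theta_2\in\mathbb R$ with $\cos(\theta_1-\theta_2)\neq0$. For all $\alpha,\beta\in\mathbb R$ the above integral defines a unique bounded operator $U(\alpha,\beta;\theta_1,\theta_2)$ on $L^2(\mathbb R)$. Moreover, for all $\alpha,\beta\in\mathbb R$, with $$X=\tfrac14(\beta^2-\alpha^2)\bigl[\sin(2\theta_2)-\sin(2\theta_1)\bigr]+\alpha\beta\,(\cos^2\theta_1-\cos^2\theta_2),$$ the operator identity $$U(0,0;\theta_1,\theta_2)\,D(\alpha,\beta)=e^{iX}\,U(-\beta\cos\theta_1-\alpha\sin\theta_1,\;\alpha\cos\theta_2-\beta\sin\theta_2;\;\theta_1,\theta_2)$$ holds, and consequently $$|\alpha,\beta;\theta_1,\theta_2\rangle_R=e^{iX}\,|-\beta\cos\theta_1-\alpha\sin\theta_1,\;\alpha\cos\theta_2-\beta\sin\theta_2;\;\theta_1,\theta_2\rangle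 .$$ -/

import Mathlib

open MeasureTheory Complex

noncomputable section

namespace Bifractional

/-- The Hilbert space `L²(ℝ)` of the harmonic oscillator, in the position representation. -/
abbrev H : Type := Lp ℂ 2 (volume : Measure ℝ)

/-- The position operator, `(x̂ f)(x) = x f(x)`. -/
def positionOp (f : ℝ → ℂ) (x : ℝ) : ℂ := (x : ℂ) * f x

/-- The momentum operator, `(p̂ f)(x) = -i f'(x)`. -/
def momentumOp (f : ℝ → ℂ) (x : ℝ) : ℂ := -I * deriv f x

/-- The displacement operator `exp(i√2 β x̂ - i√2 α p̂)` in the position representation, on functions.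
The lemmas below say that `t ↦ displacementFun (t α) (t β)` starts at the identity and solves the
evolution equation with generator `i√2 β x̂ - i√2 α p̂`. -/
def displacementFun (α β : ℝ) (f : ℝ → ℂ) (x : ℝ) : ℂ :=
  exp (I * ((√2 * β * x - α * β : ℝ) : ℂ)) * f (x - √2 * α)

theorem displacementFun_zero (f : ℝ → ℂ) : displacementFun 0 0 f = f := by
  funext x; simp [displacementFun]

theorem displacementFun_hasDerivAt (α β : ℝ) (f : ℝ → ℂ) (hf : Differentiable ℝ f) (x t : ℝ) :
    HasDerivAt (fun s : ℝ => displacementFun (s * α) (s * β) f x)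
      (I * √2 * β * positionOp (displacementFun (t * α) (t * β) f) x
        - I * √2 * α * momentumOp (displacementFun (t * α) (t * β) f) x) t := by
  have h2 : ((√2 : ℝ) : ℂ) * ((√2 : ℝ) : ℂ) = 2 := by
    rw [← ofReal_mul, Real.mul_self_sqrt (by norm_num)]; norm_num
  -- derivative in `x`
  have hx : HasDerivAt (displacementFun (t * α) (t * β) f)
      ((exp (I * ((√2 * (t * β) * x - (t * α) * (t * β) : ℝ) : ℂ)) * (I * ((√2 * (t * β) : ℝ) : ℂ)))
          * f (x - √2 * (t * α))
        + exp (I * ((√2 * (t * β) * x - (t * α) * (t * β) : ℝ) : ℂ))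
          * deriv f (x - √2 * (t * α))) x := by
    unfold displacementFun
    refine HasDerivAt.mul (HasDerivAt.cexp (HasDerivAt.const_mul _ (HasDerivAt.ofReal_comp ?_))) ?_
    · simpa using (((hasDerivAt_id x).const_mul (√2 * (t * β))).sub_const ((t * α) * (t * β)))
    · exact HasDerivAt.comp_sub_const x _ (hf _).hasDerivAt
  -- derivative in `t`
  have ht : HasDerivAt (fun s : ℝ => displacementFun (s * α) (s * β) f x)
      ((exp (I * ((√2 * (t * β) * x - (t * α) * (t * β) : ℝ) : ℂ))
          * (I * ((√2 * β * x - 2 * t * α * β : ℝ) : ℂ))) * f (x - √2 * (t * α))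
        + exp (I * ((√2 * (t * β) * x - (t * α) * (t * β) : ℝ) : ℂ))
          * ((-(√2 * α)) • deriv f (x - √2 * (t * α)))) t := by
    unfold displacementFun
    refine HasDerivAt.mul (HasDerivAt.cexp (HasDerivAt.const_mul _ (HasDerivAt.ofReal_comp ?_))) ?_
    · have h := (((hasDerivAt_id t).mul_const (√2 * β * x)).sub
        (((hasDerivAt_id t).pow 2).mul_const (α * β)))
      refine (h.congr_deriv ?_).congr_of_eventuallyEq (Filter.Eventually.of_forall fun s => ?_)
      · simp; ring
      · simp; ring
    · have h := (((hasDerivAt_id t).mul_const (√2 * α)).const_sub x)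
      have h3 : HasDerivAt (fun s : ℝ => x - √2 * (s * α)) (-(√2 * α)) t := by
        refine (h.congr_deriv (by simp)).congr_of_eventuallyEq
          (Filter.Eventually.of_forall fun s => ?_)
        simp; ring
      exact HasDerivAt.scomp t (hf _).hasDerivAt h3
  refine ht.congr_deriv ?_
  simp only [positionOp, momentumOp, hx.deriv, displacementFun]
  push_cast
  simp only [real_smul]
  push_cast
  have hI : I * I = -1 := I_mul_I
  set E := exp (I * (√2 * (t * β) * x - t * α * (t * β))) with hE
  set F := f (x - √2 * (t * α))
  set F' := deriv f (x - √2 * (t * α))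
  linear_combination (-(E * √2 * α * F' + E * I * β * t * α * F * (√2 * √2))) * hI
    + (E * I * β * t * α * F) * h2

theorem norm_displacementFun (α β : ℝ) (f : ℝ → ℂ) (x : ℝ) :
    ‖displacementFun α β f x‖ = ‖f (x - √2 * α)‖ := by
  rw [displacementFun, norm_mul, mul_comm I, norm_exp_ofReal_mul_I, one_mul]

theorem measurePreserving_shift (α : ℝ) :
    MeasurePreserving (fun x : ℝ => x - √2 * α) volume volume :=
  measurePreserving_sub_right volume _

theorem displacementFun_congr (α β : ℝ) {f g : ℝ → ℂ} (h : f =ᵐ[volume] g) :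
    displacementFun α β f =ᵐ[volume] displacementFun α β g := by
  filter_upwards [(measurePreserving_shift α).quasiMeasurePreserving.ae h] with x hx
  simp only [displacementFun, hx]

theorem memLp_displacementFun (α β : ℝ) {f : ℝ → ℂ} (hf : MemLp f 2 volume) :
    MemLp (displacementFun α β f) 2 volume := by
  have h := hf.comp_measurePreserving (measurePreserving_shift α)
  refine h.of_le ?_ (Filter.Eventually.of_forall fun x => (norm_displacementFun α β f x).le)
  refine AEStronglyMeasurable.mul ?_ h.1
  exact Continuous.aestronglyMeasurable (by fun_prop)

theorem eLpNorm_displacementFun (α β : ℝ) {f : ℝ → ℂ} (hf : MemLp f 2 volume) :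
    eLpNorm (displacementFun α β f) 2 volume = eLpNorm f 2 volume := by
  rw [← eLpNorm_comp_measurePreserving hf.1 (measurePreserving_shift α)]
  exact eLpNorm_congr_norm_ae
    (Filter.Eventually.of_forall fun x => norm_displacementFun α β f x)

/-- The displacement operator `D(α, β) = exp(i√2 β x̂ - i√2 α p̂)` on `L²(ℝ)`, an isometry. -/
def displacementIsometry (α β : ℝ) : H →ₗᵢ[ℂ] H where
  toFun ψ := (memLp_displacementFun α β (Lp.memLp ψ)).toLp _
  map_add' ψ φ := by
    rw [← MemLp.toLp_add, MemLp.toLp_eq_toLp_iff]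
    refine (displacementFun_congr α β (Lp.coeFn_add ψ φ)).trans
      (Filter.Eventually.of_forall fun x => ?_)
    simp [displacementFun, mul_add]
  map_smul' c ψ := by
    rw [RingHom.id_apply, ← MemLp.toLp_const_smul, MemLp.toLp_eq_toLp_iff]
    refine (displacementFun_congr α β (Lp.coeFn_smul c ψ)).trans
      (Filter.Eventually.of_forall fun x => ?_)
    simp [displacementFun, mul_left_comm]
  norm_map' ψ := by
    change ‖(memLp_displacementFun α β (Lp.memLp ψ)).toLp _‖ = ‖ψ‖
    rw [Lp.norm_toLp, eLpNorm_displacementFun α β (Lp.memLp ψ), Lp.norm_def]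

/-- The displacement operator `D(α, β)` as a bounded operator on `L²(ℝ)`. -/
def D (α β : ℝ) : H →L[ℂ] H := (displacementIsometry α β).toContinuousLinearMap

theorem D_coeFn (α β : ℝ) (ψ : H) : D α β ψ =ᵐ[volume] displacementFun α β ψ :=
  MemLp.coeFn_toLp (memLp_displacementFun α β (Lp.memLp ψ))

/-- The composition law of displacement operators. -/
theorem D_mul_D (α β α' β' : ℝ) :
    D α β ∘L D α' β' = exp (I * ((β * α' - α * β' : ℝ) : ℂ)) • D (α + α') (β + β') := by
  have h2 : ((√2 : ℝ) : ℂ) * ((√2 : ℝ) : ℂ) = 2 := by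
    rw [← ofReal_mul, Real.mul_self_sqrt (by norm_num)]; norm_num
  ext1 ψ
  apply Lp.ext
  rw [ContinuousLinearMap.comp_apply, smul_apply]
  filter_upwards [D_coeFn α β (D α' β' ψ), displacementFun_congr α β (D_coeFn α' β' ψ),
    Lp.coeFn_smul (exp (I * ((β * α' - α * β' : ℝ) : ℂ))) (D (α + α') (β + β') ψ),
    D_coeFn (α + α') (β + β') ψ] with x e1 e2 e3 e4
  rw [e1, e2, e3, Pi.smul_apply, e4]
  simp only [displacementFun, smul_eq_mul]
  rw [← mul_assoc, ← mul_assoc, ← Complex.exp_add, ← Complex.exp_add]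
  congr 2
  · push_cast
    linear_combination (-I * α * β') * h2
  · ring

/-- The wave function `π^{-1/4} exp(-x²/2)` of the ground state of the harmonic oscillator. -/
def vacuumFun (x : ℝ) : ℂ := ((Real.pi ^ (-(1 / 4) : ℝ) * Real.exp (-(x ^ 2) / 2) : ℝ) : ℂ)

theorem memLp_vacuumFun : MemLp vacuumFun 2 volume := by
  have hc : Continuous vacuumFun := by unfold vacuumFun; fun_prop
  rw [memLp_two_iff_integrable_sq_norm hc.aestronglyMeasurable]
  have h := (integrable_exp_neg_mul_sq (b := 1) one_pos).const_mul
    ((Real.pi ^ (-(1 / 4) : ℝ)) ^ 2)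
  refine h.congr (Filter.Eventually.of_forall fun x => ?_)
  simp only [vacuumFun, norm_real, Real.norm_eq_abs, sq_abs, mul_pow, ← Real.exp_nat_mul]
  congr 2
  push_cast
  ring

/-- The vacuum `|0⟩`. -/
def vacuum : H := memLp_vacuumFun.toLp _

/-- The vacuum is annihilated by `a = (x̂ + i p̂) / √2`. -/
theorem annihilation_vacuumFun (x : ℝ) :
    positionOp vacuumFun x + I * momentumOp vacuumFun x = 0 := by
  have h : HasDerivAt vacuumFun
      ((Real.pi ^ (-(1 / 4) : ℝ) * (Real.exp (-(x ^ 2) / 2) * (-x)) : ℝ) : ℂ) x := by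
    unfold vacuumFun
    refine HasDerivAt.ofReal_comp (HasDerivAt.const_mul _ (HasDerivAt.exp ?_))
    refine (((hasDerivAt_id x).pow 2).neg.div_const 2).congr_deriv ?_
    simp
    ring
  simp only [positionOp, momentumOp, h.deriv, vacuumFun]
  push_cast
  linear_combination (-(Real.pi ^ (-(1 / 4) : ℝ) : ℝ) * exp (-(x : ℂ) ^ 2 / 2) * (-x)) * I_mul_I

/-- The standard coherent state `|α, β⟩ = D(α, β)|0⟩`. -/
def coherent (α β : ℝ) : H := D α β vacuum

/-- The kernel of the fractional Fourier transform `Δ(x, y; θ)` is the generalized function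
`fracDensity θ x y` times the measure `fracMeasure θ x` in the variable `y`.
When `sin θ ≠ 0` it is the function
`((1 + i cot θ) / 2π)^{1/2} exp(-i (x² + y²) cot θ / 2 + i x y / sin θ)` (principal square root);
when `θ` is a multiple of `π` it is `δ(x - y)` or `δ(x + y)`, that is, the unit mass at
`y = x cos θ`. -/
def fracDensity (θ x y : ℝ) : ℂ :=
  if Real.sin θ = 0 then 1
  else ((1 + I * (Real.cot θ : ℂ)) / (2 * Real.pi)) ^ (1 / 2 : ℂ) *
    exp (-I * (x ^ 2 + y ^ 2) * (Real.cot θ : ℂ) / 2 + I * x * y / (Real.sin θ : ℂ))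

/-- The measure part of the kernel `Δ(x, y; θ)`, in the variable `y`; see `fracDensity`. -/
def fracMeasure (θ x : ℝ) : Measure ℝ :=
  if Real.sin θ = 0 then Measure.dirac (x * Real.cos θ) else volume

/-- The measure part of `Δ(β, α'; θ₂) Δ(α, -β'; θ₁) dα' dβ'`, in the variables `(α', β')`. -/
def bifracMeasure (α β θ₁ θ₂ : ℝ) : Measure (ℝ × ℝ) :=
  (fracMeasure θ₂ β).prod ((fracMeasure θ₁ α).map (fun y => -y))

/-- `T` is the operator
`|cos(θ₁ - θ₂)|^{1/2} ∫ dα' dβ' Δ(β, α'; θ₂) Δ(α, -β'; θ₁) D(α', β')`.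
The operator integral is taken weakly, that is, through its matrix elements between Schwartz
functions (for which it converges absolutely). -/
def IsBifractional (α β θ₁ θ₂ : ℝ) (T : H →L[ℂ] H) : Prop :=
  ∀ φ ψ : SchwartzMap ℝ ℂ,
    Integrable (fun z : ℝ × ℝ => fracDensity θ₂ β z.1 * fracDensity θ₁ α (-z.2) *
      inner ℂ (φ.toLp 2 volume : H) (D z.1 z.2 (ψ.toLp 2 volume))) (bifracMeasure α β θ₁ θ₂) ∧
    inner ℂ (φ.toLp 2 volume : H) (T (ψ.toLp 2 volume)) =
      ((|Real.cos (θ₁ - θ₂)| ^ (1 / 2 : ℝ) : ℝ) : ℂ) *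
        ∫ z : ℝ × ℝ, fracDensity θ₂ β z.1 * fracDensity θ₁ α (-z.2) *
          inner ℂ (φ.toLp 2 volume : H) (D z.1 z.2 (ψ.toLp 2 volume)) ∂(bifracMeasure α β θ₁ θ₂)

open Classical in
/-- The bifractional displacement operator `U(α, β; θ₁, θ₂)`, the bounded operator given by the
weak integral in `IsBifractional` (and `0` if there is none). -/
def U (α β θ₁ θ₂ : ℝ) : H →L[ℂ] H :=
  if h : ∃ T, IsBifractional α β θ₁ θ₂ T then h.choose else 0

/-- The bifractional coherent state `|α, β; θ₁, θ₂⟩ = U(α, β; θ₁, θ₂)|0⟩`. -/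
def bifracCoherent (α β θ₁ θ₂ : ℝ) : H := U α β θ₁ θ₂ vacuum

/-- The R-bifractional coherent state `|α, β; θ₁, θ₂⟩_R = U(0, 0; θ₁, θ₂)|α, β⟩`. -/
def bifracCoherentR (α β θ₁ θ₂ : ℝ) : H := U 0 0 θ₁ θ₂ (coherent α β)

/-- The phase `X`. -/
def phaseX (α β θ₁ θ₂ : ℝ) : ℝ :=
  1 / 4 * (β ^ 2 - α ^ 2) * (Real.sin (2 * θ₂) - Real.sin (2 * θ₁))
    + α * β * (Real.cos θ₁ ^ 2 - Real.cos θ₂ ^ 2)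

end Bifractional

end

noncomputable section

namespace Bifractional

open Filter Topology ComplexConjugate

/-! The identity is covariance of the kernel. Multiplying `D(α', β')` on the right by `D(α, β)`
translates the integration variables and adds a phase linear in them. The kernel is a Gaussian
phase, so completing the square absorbs this linear phase into a shift of the kernel's first
argument and leaves the constant `e^{iX}` (`fracDensity_zero_mul_exp`, `IsBifractional.comp_D`).
Hence `e^{-iX} U(0,0) D(α, β)` satisfies the relation defining `U` at the new point, and density of
Schwartz functions in `L²` makes its solution unique.

The map from `(α, β)` to the new point has determinant `cos(θ₁ - θ₂) ≠ 0`, so existence at the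
origin gives existence everywhere (`IsBifractional.exists_of_zero`).

At the origin the kernel is a product of chirps and point masses. Absolute convergence follows from
decay of `⟨φ|D(z)|ψ⟩` (`exists_norm_matrixElement_le`). For boundedness, the chirp is damped and `‖∫
f(v) D(v)ψ dv‖²` is expanded as a double integral: up to a symplectic phase its inner products
depend only on the difference of the variables, so it is at most `‖ψ‖²` times the `L¹` norm of the
twisted autocorrelation of `f` (`norm_sq_integral_smul_D_le`). For damped chirps this
autocorrelation is dominated by a Gaussian whose integral does not depend on the damping, which can
then be removed. -/

/-! ### Matrix elements between Schwartz functions and their decay. -/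

theorem iteratedDeriv_cexp_mul_ofReal (c : ℂ) (n : ℕ) :
    iteratedDeriv n (fun x : ℝ => exp (c * x)) = fun x : ℝ => c ^ n * exp (c * x) := by
  induction n with
  | zero => simp
  | succ n ih =>
    rw [iteratedDeriv_succ, ih]
    funext x
    have h : HasDerivAt (fun x : ℝ => c ^ n * exp (c * x)) (c ^ n * (exp (c * x) * (c * 1))) x :=
      ((HasDerivAt.const_mul c (hasDerivAt_id x).ofReal_comp).cexp).const_mul _
    rw [h.deriv]
    ring

theorem hasTemperateGrowth_cexp_I_mul (c : ℝ) :
    Function.HasTemperateGrowth (fun x : ℝ => exp (I * c * x)) := by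
  refine ⟨(contDiff_const.mul ofRealCLM.contDiff).cexp, fun n => ⟨0, |c| ^ n, fun x => ?_⟩⟩
  rw [norm_iteratedFDeriv_eq_norm_iteratedDeriv, iteratedDeriv_cexp_mul_ofReal]
  have h : I * c * x = ((c * x : ℝ) : ℂ) * I := by push_cast; ring
  simp [h, norm_exp_ofReal_mul_I, -ofReal_mul]

theorem hasTemperateGrowth_displacementPhase (α β : ℝ) :
    Function.HasTemperateGrowth
      (fun x : ℝ => exp (I * ((√2 * β * x - α * β : ℝ) : ℂ))) := by
  have h := (Function.HasTemperateGrowth.const (E := ℝ) (exp (I * ((-(α * β) : ℝ) : ℂ)))).mul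
    (hasTemperateGrowth_cexp_I_mul (√2 * β))
  refine Eq.mp (congrArg _ (funext fun x => ?_)) h
  rw [Pi.mul_apply, ← Complex.exp_add]
  congr 1
  push_cast
  ring

/-- The displacement operator on Schwartz functions. -/
def schwartzDisplacement (α β : ℝ) (ψ : SchwartzMap ℝ ℂ) : SchwartzMap ℝ ℂ :=
  SchwartzMap.smulLeftCLM ℂ (fun x : ℝ => exp (I * ((√2 * β * x - α * β : ℝ) : ℂ)))
    (ψ.compSubConstCLM ℂ (√2 * α))

theorem schwartzDisplacement_apply (α β : ℝ) (ψ : SchwartzMap ℝ ℂ) (x : ℝ) :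
    schwartzDisplacement α β ψ x = displacementFun α β ψ x := by
  rw [schwartzDisplacement,
    SchwartzMap.smulLeftCLM_apply_apply (hasTemperateGrowth_displacementPhase α β)]
  rfl

/-- Since displacements preserve Schwartz vectors, the weak definition of `U` can be tested on `D(α,
β)ψ`. -/
theorem D_toLp (α β : ℝ) (ψ : SchwartzMap ℝ ℂ) :
    D α β (ψ.toLp 2 volume) = (schwartzDisplacement α β ψ).toLp 2 volume := by
  apply Lp.ext
  filter_upwards [D_coeFn α β (ψ.toLp 2 volume), displacementFun_congr α β (ψ.coeFn_toLp 2 volume),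
    (schwartzDisplacement α β ψ).coeFn_toLp 2 volume] with x h1 h2 h3
  rw [h1, h2, h3, schwartzDisplacement_apply]

/-- The matrix element `⟨φ| D(α, β) |ψ⟩` between Schwartz functions. -/
def matrixElement (φ ψ : SchwartzMap ℝ ℂ) (z : ℝ × ℝ) : ℂ :=
  inner ℂ (φ.toLp 2 volume : H) (D z.1 z.2 (ψ.toLp 2 volume))

theorem matrixElement_eq_integral (φ ψ : SchwartzMap ℝ ℂ) (z : ℝ × ℝ) :
    matrixElement φ ψ z = ∫ x, conj (φ x) * displacementFun z.1 z.2 ψ x := by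
  rw [matrixElement, D_toLp]
  refine (SchwartzMap.inner_toL2_toL2_eq φ _ volume).trans ?_
  refine integral_congr_ae (Eventually.of_forall fun x => ?_)
  simp only [RCLike.inner_apply, schwartzDisplacement_apply]
  ring

theorem integrable_conj_mul_displacementFun (φ ψ : SchwartzMap ℝ ℂ) (z : ℝ × ℝ) :
    Integrable fun x => conj (φ x) * displacementFun z.1 z.2 ψ x := by
  have h : MemLp (fun x => conj (φ x)) 2 volume := (φ.memLp 2 volume).star
  have h' : MemLp (displacementFun z.1 z.2 ψ) 2 volume :=
    memLp_displacementFun _ _ (ψ.memLp 2 volume)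
  exact h.integrable_mul h'

theorem norm_D (α β : ℝ) (ψ : H) : ‖D α β ψ‖ = ‖ψ‖ :=
  (displacementIsometry α β).norm_map ψ

theorem norm_matrixElement_le (φ ψ : SchwartzMap ℝ ℂ) (z : ℝ × ℝ) :
    ‖matrixElement φ ψ z‖ ≤ ‖(φ.toLp 2 volume : H)‖ * ‖(ψ.toLp 2 volume : H)‖ := by
  refine (norm_inner_le_norm _ _).trans_eq ?_
  rw [norm_D]

theorem continuous_matrixElement (φ ψ : SchwartzMap ℝ ℂ) : Continuous (matrixElement φ ψ) := by
  have h : matrixElement φ ψ = fun z => ∫ x, conj (φ x) * displacementFun z.1 z.2 ψ x :=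
    funext (matrixElement_eq_integral φ ψ)
  rw [h]
  obtain ⟨C, -, hC⟩ := ψ.decay 0 0
  have hφ : Integrable (fun x => ‖φ x‖) := φ.integrable.norm
  refine continuous_of_dominated (bound := fun x => ‖φ x‖ * C) (fun z => ?_) (fun z => ?_)
    (hφ.mul_const C) (Eventually.of_forall fun x => ?_)
  · exact (integrable_conj_mul_displacementFun φ ψ z).1
  · refine Eventually.of_forall fun x => ?_
    rw [norm_mul, norm_displacementFun, RCLike.norm_conj]
    gcongr
    simpa using hC (x - √2 * z.1)
  · unfold displacementFun
    have := ψ.continuous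
    fun_prop

/-- Multiplication by the coordinate, on Schwartz functions. -/
def schwartzPosition (ψ : SchwartzMap ℝ ℂ) : SchwartzMap ℝ ℂ :=
  SchwartzMap.smulLeftCLM ℂ (fun x : ℝ => (x : ℂ)) ψ

theorem schwartzPosition_apply (ψ : SchwartzMap ℝ ℂ) (x : ℝ) :
    schwartzPosition ψ x = x * ψ x := by
  rw [schwartzPosition, SchwartzMap.smulLeftCLM_apply_apply Function.Complex.hasTemperateGrowth_ofReal,
    smul_eq_mul]

/-- This is the commutator `[x̂, D(α, β)] = √2 α D(α, β)`: a factor of `α` is traded for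
multiplications by `x` on `φ` and `ψ`. -/
theorem fst_mul_matrixElement (φ ψ : SchwartzMap ℝ ℂ) (z : ℝ × ℝ) :
    ((√2 * z.1 : ℝ) : ℂ) * matrixElement φ ψ z =
      matrixElement (schwartzPosition φ) ψ z - matrixElement φ (schwartzPosition ψ) z := by
  simp only [matrixElement_eq_integral]
  rw [← integral_sub (integrable_conj_mul_displacementFun _ _ z)
    (integrable_conj_mul_displacementFun _ _ z), ← integral_const_mul]
  refine integral_congr_ae (Eventually.of_forall fun x => ?_)
  simp only [displacementFun, schwartzPosition_apply, map_mul, conj_ofReal]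
  push_cast
  ring

/-- Integration by parts: differentiating the phase of `D(α, β)` produces the factor `i√2 β`, and
the total derivative integrates to zero. -/
theorem snd_mul_matrixElement (φ ψ : SchwartzMap ℝ ℂ) (z : ℝ × ℝ) :
    I * ((√2 * z.2 : ℝ) : ℂ) * matrixElement φ ψ z =
      -matrixElement (SchwartzMap.derivCLM ℂ ℂ φ) ψ z
        - matrixElement φ (SchwartzMap.derivCLM ℂ ℂ ψ) z := by
  have hderiv : ∀ x, HasDerivAt (fun x => conj (φ x) * displacementFun z.1 z.2 ψ x)
      (conj (SchwartzMap.derivCLM ℂ ℂ φ x) * displacementFun z.1 z.2 ψ x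
        + (I * ((√2 * z.2 : ℝ) : ℂ) * (conj (φ x) * displacementFun z.1 z.2 ψ x)
          + conj (φ x) * displacementFun z.1 z.2 (SchwartzMap.derivCLM ℂ ℂ ψ) x)) x := by
    intro x
    have h1 : HasDerivAt (fun x => conj (φ x)) (conj (deriv φ x)) x := (φ.hasDerivAt x).star
    have h2 : HasDerivAt (fun x : ℝ => √2 * z.2 * x - z.1 * z.2) (√2 * z.2) x := by
      simpa using ((hasDerivAt_id x).const_mul (√2 * z.2)).sub_const (z.1 * z.2)
    have h3 := ((h2.ofReal_comp.const_mul I).cexp).mul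
      (HasDerivAt.comp_sub_const x (√2 * z.1) (ψ.hasDerivAt (x - √2 * z.1)))
    refine (h1.mul h3).congr_deriv ?_
    simp only [displacementFun, SchwartzMap.derivCLM_apply, Pi.mul_apply]
    ring
  have i1 := integrable_conj_mul_displacementFun (SchwartzMap.derivCLM ℂ ℂ φ) ψ z
  have i2 := (integrable_conj_mul_displacementFun φ ψ z).const_mul (I * ((√2 * z.2 : ℝ) : ℂ))
  have i3 := integrable_conj_mul_displacementFun φ (SchwartzMap.derivCLM ℂ ℂ ψ) z
  have h := integral_eq_zero_of_hasDerivAt_of_integrable hderiv (i1.add (i2.add i3))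
    (integrable_conj_mul_displacementFun φ ψ z)
  rw [integral_add i1 (by exact i2.add i3), integral_add i2 i3, integral_const_mul] at h
  simp only [matrixElement_eq_integral]
  linear_combination h

/-- The hypothesis ranges over all `φ`, `ψ` because the commutator changes them; this also lets the
lemma be iterated. -/
theorem exists_norm_fst_mul_le {P : ℝ × ℝ → ℂ}
    (h : ∀ φ ψ : SchwartzMap ℝ ℂ, ∃ C : ℝ, ∀ z, ‖P z * matrixElement φ ψ z‖ ≤ C)
    (φ ψ : SchwartzMap ℝ ℂ) :
    ∃ C : ℝ, ∀ z, ‖(z.1 * P z) * matrixElement φ ψ z‖ ≤ C := by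
  obtain ⟨C₁, h₁⟩ := h (schwartzPosition φ) ψ
  obtain ⟨C₂, h₂⟩ := h φ (schwartzPosition ψ)
  refine ⟨(√2)⁻¹ * (C₁ + C₂), fun z => ?_⟩
  have h2 : ((√2 : ℝ) : ℂ) ≠ 0 := by simp
  have e : (z.1 * P z) * matrixElement φ ψ z = ((√2)⁻¹ : ℝ) *
      (P z * matrixElement (schwartzPosition φ) ψ z - P z * matrixElement φ (schwartzPosition ψ) z) := by
    rw [← mul_sub, ← fst_mul_matrixElement]
    push_cast
    field_simp
  rw [e, norm_mul, norm_real, Real.norm_of_nonneg (by positivity)]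
  gcongr
  exact (norm_sub_le _ _).trans (add_le_add (h₁ z) (h₂ z))

theorem exists_norm_snd_mul_le {P : ℝ × ℝ → ℂ}
    (h : ∀ φ ψ : SchwartzMap ℝ ℂ, ∃ C : ℝ, ∀ z, ‖P z * matrixElement φ ψ z‖ ≤ C)
    (φ ψ : SchwartzMap ℝ ℂ) :
    ∃ C : ℝ, ∀ z, ‖(z.2 * P z) * matrixElement φ ψ z‖ ≤ C := by
  obtain ⟨C₁, h₁⟩ := h (SchwartzMap.derivCLM ℂ ℂ φ) ψ
  obtain ⟨C₂, h₂⟩ := h φ (SchwartzMap.derivCLM ℂ ℂ ψ)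
  refine ⟨(√2)⁻¹ * (C₁ + C₂), fun z => ?_⟩
  have h2 : ((√2 : ℝ) : ℂ) ≠ 0 := by simp
  have e : (z.2 * P z) * matrixElement φ ψ z = (-I * ((√2)⁻¹ : ℝ)) *
      (-(P z * matrixElement (SchwartzMap.derivCLM ℂ ℂ φ) ψ z)
        - P z * matrixElement φ (SchwartzMap.derivCLM ℂ ℂ ψ) z) := by
    rw [← mul_neg, ← mul_sub, ← snd_mul_matrixElement]
    push_cast
    field_simp
    linear_combination ((z.2 : ℂ) * P z * matrixElement φ ψ z) * I_sq
  rw [e, norm_mul, norm_mul, norm_neg, norm_I, one_mul, norm_real,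
    Real.norm_of_nonneg (by positivity)]
  gcongr
  refine (norm_sub_le _ _).trans (add_le_add ?_ (h₂ z))
  rw [norm_neg]
  exact h₁ z

theorem exists_norm_matrixElement_le (φ ψ : SchwartzMap ℝ ℂ) :
    ∃ C : ℝ, ∀ z, ‖matrixElement φ ψ z‖ ≤ C * ((1 + z.1 ^ 2)⁻¹ * (1 + z.2 ^ 2)⁻¹) := by
  have h0 : ∀ φ ψ : SchwartzMap ℝ ℂ, ∃ C : ℝ, ∀ z,
      ‖(fun _ : ℝ × ℝ => (1 : ℂ)) z * matrixElement φ ψ z‖ ≤ C := fun φ ψ =>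
    ⟨_, fun z => by simpa using norm_matrixElement_le φ ψ z⟩
  -- The weights `1`, `α²`, `β²`, `α²β²` add up to `(1 + α²)(1 + β²)`.
  have h1 := exists_norm_fst_mul_le (exists_norm_fst_mul_le h0)
  have h2 := exists_norm_snd_mul_le (exists_norm_snd_mul_le h0)
  have h3 := exists_norm_snd_mul_le (exists_norm_snd_mul_le h1)
  obtain ⟨C₀, h0⟩ := h0 φ ψ
  obtain ⟨C₁, h1⟩ := h1 φ ψ
  obtain ⟨C₂, h2⟩ := h2 φ ψ
  obtain ⟨C₃, h3⟩ := h3 φ ψ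
  refine ⟨C₀ + C₁ + C₂ + C₃, fun z => ?_⟩
  have p1 : 0 < 1 + z.1 ^ 2 := by positivity
  have p2 : 0 < 1 + z.2 ^ 2 := by positivity
  rw [← mul_inv, ← div_eq_mul_inv, le_div_iff₀ (by positivity)]
  specialize h0 z
  specialize h1 z
  specialize h2 z
  specialize h3 z
  simp only [norm_mul, norm_real, Real.norm_eq_abs, mul_one, one_mul] at h0 h1 h2 h3
  linear_combination h0 + h1 + h2 + h3 + ‖matrixElement φ ψ z‖ * (sq_abs z.1).symm
    + ‖matrixElement φ ψ z‖ * (sq_abs z.2).symm * (1 + z.1 ^ 2)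
    + ‖matrixElement φ ψ z‖ * (sq_abs z.1).symm * |z.2| ^ 2

theorem integrable_matrixElement (φ ψ : SchwartzMap ℝ ℂ) :
    Integrable (matrixElement φ ψ) := by
  obtain ⟨C, hC⟩ := exists_norm_matrixElement_le φ ψ
  refine ((integrable_inv_one_add_sq.mul_prod integrable_inv_one_add_sq).const_mul C).mono'
    (continuous_matrixElement φ ψ).aestronglyMeasurable (Eventually.of_forall hC)

theorem integrable_matrixElement_fst (φ ψ : SchwartzMap ℝ ℂ) (b : ℝ) :
    Integrable (fun a => matrixElement φ ψ (a, b)) := by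
  obtain ⟨C, hC⟩ := exists_norm_matrixElement_le φ ψ
  refine ((integrable_inv_one_add_sq.mul_const (1 + b ^ 2)⁻¹).const_mul C).mono'
    ((continuous_matrixElement φ ψ).comp (by fun_prop)).aestronglyMeasurable
    (Eventually.of_forall fun a => hC (a, b))

theorem integrable_matrixElement_snd (φ ψ : SchwartzMap ℝ ℂ) (a : ℝ) :
    Integrable (fun b => matrixElement φ ψ (a, b)) := by
  obtain ⟨C, hC⟩ := exists_norm_matrixElement_le φ ψ
  refine ((integrable_inv_one_add_sq.const_mul (1 + a ^ 2)⁻¹).const_mul C).mono'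
    ((continuous_matrixElement φ ψ).comp (by fun_prop)).aestronglyMeasurable
    (Eventually.of_forall fun b => hC (a, b))

/-! ### Weyl relations, strong continuity and density. -/

/-- The composition law of displacement operators, applied to a vector. -/
theorem D_D (α β α' β' : ℝ) (ψ : H) :
    D α β (D α' β' ψ) = exp (I * ((β * α' - α * β' : ℝ) : ℂ)) • D (α + α') (β + β') ψ := by
  simpa using DFunLike.congr_fun (D_mul_D α β α' β') ψ

theorem D_zero : D 0 0 = ContinuousLinearMap.id ℂ H := by
  ext1 ψ
  apply Lp.ext
  filter_upwards [D_coeFn 0 0 ψ] with x hx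
  rw [hx, displacementFun_zero]
  rfl

theorem inner_D_D (z w : ℝ × ℝ) (φ ψ : H) :
    inner ℂ (D z.1 z.2 φ) (D w.1 w.2 ψ) =
      exp (I * ((z.1 * w.2 - z.2 * w.1 : ℝ) : ℂ)) *
        inner ℂ φ (D (w.1 - z.1) (w.2 - z.2) ψ) := by
  have h : inner ℂ (D (-z.1) (-z.2) (D z.1 z.2 φ)) (D (-z.1) (-z.2) (D w.1 w.2 ψ)) =
      inner ℂ (D z.1 z.2 φ) (D w.1 w.2 ψ) :=
    (displacementIsometry (-z.1) (-z.2)).inner_map_map _ _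
  rw [← h, D_D, D_D, neg_add_cancel, neg_add_cancel, D_zero, inner_smul_left, inner_smul_right,
    ContinuousLinearMap.id_apply, neg_add_eq_sub, neg_add_eq_sub,
    show -z.2 * z.1 - -z.1 * z.2 = 0 by ring,
    show -z.2 * w.1 - -z.1 * w.2 = z.1 * w.2 - z.2 * w.1 by ring]
  simp

/-- Strong continuity provides the measurability needed for Bochner integrals of `f(v) D(L v)ψ`.
Expanding the squared distance and using unitarity reduces it to continuity of a matrix element. -/
theorem continuous_D_toLp (ψ : SchwartzMap ℝ ℂ) :
    Continuous fun z : ℝ × ℝ => D z.1 z.2 (ψ.toLp 2 volume) := by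
  rw [continuous_iff_continuousAt]
  intro z
  rw [ContinuousAt, tendsto_iff_norm_sub_tendsto_zero]
  have e : ∀ w : ℝ × ℝ, ‖D w.1 w.2 (ψ.toLp 2 volume) - D z.1 z.2 (ψ.toLp 2 volume)‖ =
      √(2 * ‖(ψ.toLp 2 volume : H)‖ ^ 2 -
        2 * (exp (I * ((w.1 * z.2 - w.2 * z.1 : ℝ) : ℂ)) * matrixElement ψ ψ (z - w)).re) := by
    intro w
    have h := norm_sub_sq (𝕜 := ℂ) (D w.1 w.2 (ψ.toLp 2 volume)) (D z.1 z.2 (ψ.toLp 2 volume))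
    rw [norm_D, norm_D, inner_D_D] at h
    rw [eq_comm, Real.sqrt_eq_iff_mul_self_eq _ (norm_nonneg _), ← sq, h]
    · simp only [matrixElement, RCLike.re_to_complex, Prod.fst_sub, Prod.snd_sub]
      ring
    · have := sq_nonneg ‖D w.1 w.2 (ψ.toLp 2 volume) - D z.1 z.2 (ψ.toLp 2 volume)‖
      rw [h] at this
      simp only [matrixElement, RCLike.re_to_complex, Prod.fst_sub, Prod.snd_sub] at this ⊢
      linarith
  simp_rw [e]
  have hc : Continuous fun w : ℝ × ℝ => √(2 * ‖(ψ.toLp 2 volume : H)‖ ^ 2 -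
        2 * (exp (I * ((w.1 * z.2 - w.2 * z.1 : ℝ) : ℂ)) * matrixElement ψ ψ (z - w)).re) := by
    have := continuous_matrixElement ψ ψ
    fun_prop
  have h0 := e z
  rw [sub_self, norm_zero] at h0
  have h1 := hc.tendsto z
  rwa [← h0] at h1

theorem denseRange_schwartz_toLp :
    DenseRange (fun φ : SchwartzMap ℝ ℂ => (φ.toLp 2 volume : H)) :=
  SchwartzMap.denseRange_toLpCLM (F := ℂ) (μ := (volume : Measure ℝ)) ENNReal.ofNat_ne_top

theorem ext_inner_schwartz {u v : H}
    (h : ∀ φ : SchwartzMap ℝ ℂ,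
      inner ℂ (φ.toLp 2 volume : H) u = inner ℂ (φ.toLp 2 volume : H) v) : u = v := by
  refine ext_inner_left ℂ fun w => ?_
  have hu : Continuous fun w : H => (inner ℂ w u : ℂ) := by fun_prop
  have hv : Continuous fun w : H => (inner ℂ w v : ℂ) := by fun_prop
  exact congrFun (denseRange_schwartz_toLp.equalizer hu hv (funext h)) w

theorem clm_ext_schwartz {S T : H →L[ℂ] H}
    (h : ∀ φ ψ : SchwartzMap ℝ ℂ, inner ℂ (φ.toLp 2 volume : H) (S (ψ.toLp 2 volume)) =
      inner ℂ (φ.toLp 2 volume : H) (T (ψ.toLp 2 volume))) : S = T :=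
  ContinuousLinearMap.coeFn_injective <|
    denseRange_schwartz_toLp.equalizer S.continuous T.continuous <|
      funext fun ψ => ext_inner_schwartz fun φ => h φ ψ

theorem IsBifractional.unique {α β θ₁ θ₂ : ℝ} {S T : H →L[ℂ] H}
    (hS : IsBifractional α β θ₁ θ₂ S) (hT : IsBifractional α β θ₁ θ₂ T) : S = T :=
  clm_ext_schwartz fun φ ψ => (hS φ ψ).2.trans (hT φ ψ).2.symm

/-! ### Covariance of the kernel under displacements. -/

instance (θ x : ℝ) : SFinite (fracMeasure θ x) := by
  unfold fracMeasure
  split_ifs <;> infer_instance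

/-- Lebesgue measure is invariant under every shift; only a point mass constrains `s`. -/
theorem fracMeasure_eq_map_add (θ x s : ℝ) (h : Real.sin θ = 0 → x * Real.cos θ = s) :
    fracMeasure θ x = (fracMeasure θ 0).map (fun y => y + s) := by
  unfold fracMeasure
  split_ifs with h0
  · rw [Measure.map_dirac' (by fun_prop), h h0, zero_mul, zero_add]
  · exact (map_add_right_eq_self volume s).symm

theorem bifracMeasure_eq_map_add {α β θ₁ θ₂ : ℝ} (s t : ℝ)
    (h₂ : Real.sin θ₂ = 0 → β * Real.cos θ₂ = s) (h₁ : Real.sin θ₁ = 0 → α * Real.cos θ₁ = -t) :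
    bifracMeasure α β θ₁ θ₂ = (bifracMeasure 0 0 θ₁ θ₂).map (fun z => z + (s, t)) := by
  unfold bifracMeasure
  rw [fracMeasure_eq_map_add θ₂ β s h₂, fracMeasure_eq_map_add θ₁ α (-t) h₁,
    Measure.map_map (by fun_prop) (by fun_prop)]
  have e : ((fun y : ℝ => -y) ∘ fun y => y + -t) = (fun y => y + t) ∘ fun y => -y := by
    funext y
    simp [add_comm]
  rw [e, ← Measure.map_map (by fun_prop) (by fun_prop),
    Measure.map_prod_map _ _ (by fun_prop) (by fun_prop)]
  rfl

/-- The square is completed with `x = s cos θ - t sin θ`, chosen so that the terms linear in `y`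
cancel. When `sin θ = 0` the identity is needed only at `y = 0`, hence the almost-everywhere form.
-/
theorem fracDensity_zero_mul_exp (θ s t : ℝ) : ∀ᵐ y ∂(fracMeasure θ 0),
    fracDensity θ 0 y * exp (I * ((-(y * t) : ℝ) : ℂ)) =
      exp (I * ((1 / 4 * (t ^ 2 - s ^ 2) * Real.sin (2 * θ) + s * t * Real.sin θ ^ 2 : ℝ) : ℂ)) *
        fracDensity θ (s * Real.cos θ - t * Real.sin θ) (y + s) := by
  by_cases h0 : Real.sin θ = 0
  · rw [fracMeasure, if_pos h0, ae_dirac_eq]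
    simp [fracDensity, h0, Real.sin_two_mul]
  refine Eventually.of_forall fun y => ?_
  simp only [fracDensity, if_neg h0]
  rw [mul_assoc, mul_left_comm (exp _), ← Complex.exp_add, ← Complex.exp_add]
  congr 2
  have h0' : ((Real.sin θ : ℝ) : ℂ) ≠ 0 := ofReal_ne_zero.2 h0
  have hp : ((Real.sin θ : ℝ) : ℂ) ^ 2 + ((Real.cos θ : ℝ) : ℂ) ^ 2 = 1 := by
    exact_mod_cast Real.sin_sq_add_cos_sq θ
  rw [Real.cot_eq_cos_div_sin, Real.sin_two_mul]
  simp only [ofReal_add, ofReal_mul, ofReal_sub, ofReal_neg, ofReal_div, ofReal_pow, ofReal_one,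
    ofReal_zero, ofReal_ofNat]
  generalize ((Real.sin θ : ℝ) : ℂ) = n at *
  generalize ((Real.cos θ : ℝ) : ℂ) = c at *
  field_simp
  linear_combination 4 * (c * s ^ 2 - 2 * s * t * n) * hp

theorem IsBifractional.comp_D {θ₁ θ₂ : ℝ} {T : H →L[ℂ] H} (hT : IsBifractional 0 0 θ₁ θ₂ T)
    (α β : ℝ) :
    IsBifractional (-β * Real.cos θ₁ - α * Real.sin θ₁) (α * Real.cos θ₂ - β * Real.sin θ₂) θ₁ θ₂
      (exp (-(I * (phaseX α β θ₁ θ₂ : ℂ))) • (T ∘L D α β)) := by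
  intro φ ψ
  obtain ⟨hi, he⟩ := hT φ (schwartzDisplacement α β ψ)
  rw [bifracMeasure_eq_map_add α β (fun h => ?_) (fun h => ?_)]
  rotate_left
  -- When a sine vanishes, `cos² = 1` places the point mass exactly at the translated position.
  · have := Real.sin_sq_add_cos_sq θ₂
    rw [h] at this ⊢
    linear_combination α * this
  · have := Real.sin_sq_add_cos_sq θ₁
    rw [h] at this ⊢
    linear_combination -β * this
  have hemb : MeasurableEmbedding fun z : ℝ × ℝ => z + (α, β) :=
    (MeasurableEquiv.addRight (α, β)).measurableEmbedding
  rw [hemb.integrable_map_iff, hemb.integral_map]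
  have key : (fun z : ℝ × ℝ => fracDensity θ₂ 0 z.1 * fracDensity θ₁ 0 (-z.2) *
      inner ℂ (φ.toLp 2 volume : H)
        (D z.1 z.2 ((schwartzDisplacement α β ψ).toLp 2 volume))) =ᵐ[bifracMeasure 0 0 θ₁ θ₂]
      fun z => exp (I * (phaseX α β θ₁ θ₂ : ℂ)) *
        (fracDensity θ₂ (α * Real.cos θ₂ - β * Real.sin θ₂) (z.1 + α) *
          fracDensity θ₁ (-β * Real.cos θ₁ - α * Real.sin θ₁) (-(z.2 + β)) *
          inner ℂ (φ.toLp 2 volume : H) (D (z.1 + α) (z.2 + β) (ψ.toLp 2 volume))) := by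
    have h2 := Measure.quasiMeasurePreserving_fst (μ := fracMeasure θ₂ 0)
      (ν := (fracMeasure θ₁ 0).map (fun y => -y)) |>.ae (fracDensity_zero_mul_exp θ₂ α β)
    -- The second kernel is evaluated at `-β'`, so its shift parameters are `(s, t) = (-β, α)`,
    -- against `(α, β)` for the first.
    have h1 := Measure.quasiMeasurePreserving_snd (μ := fracMeasure θ₂ 0)
      (ν := (fracMeasure θ₁ 0).map (fun y => -y)) |>.ae
        (p := fun b => fracDensity θ₁ 0 (-b) * exp (I * ((-(-b * α) : ℝ) : ℂ)) =
          exp (I * ((1 / 4 * (α ^ 2 - (-β) ^ 2) * Real.sin (2 * θ₁)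
            + -β * α * Real.sin θ₁ ^ 2 : ℝ) : ℂ)) *
            fracDensity θ₁ (-β * Real.cos θ₁ - α * Real.sin θ₁) (-b + -β)) (by
        have hneg : MeasurableEmbedding fun y : ℝ => -y :=
          (MeasurableEquiv.neg ℝ).measurableEmbedding
        rw [hneg.ae_map_iff]
        filter_upwards [fracDensity_zero_mul_exp θ₁ (-β) α] with y hy
        rw [neg_neg]
        exact hy)
    filter_upwards [h1, h2] with z h1 h2
    rw [← D_toLp, D_D, inner_smul_right]
    have hphase : exp (I * ((z.2 * α - z.1 * β : ℝ) : ℂ)) =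
        exp (I * ((-(z.1 * β) : ℝ) : ℂ)) * exp (I * ((-(-z.2 * α) : ℝ) : ℂ)) := by
      rw [← Complex.exp_add]
      congr 1
      push_cast
      ring
    have hX : exp (I * (phaseX α β θ₁ θ₂ : ℂ)) =
        exp (I * ((1 / 4 * (β ^ 2 - α ^ 2) * Real.sin (2 * θ₂)
            + α * β * Real.sin θ₂ ^ 2 : ℝ) : ℂ)) *
          exp (I * ((1 / 4 * (α ^ 2 - (-β) ^ 2) * Real.sin (2 * θ₁)
            + -β * α * Real.sin θ₁ ^ 2 : ℝ) : ℂ)) := by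
      rw [← Complex.exp_add, ← mul_add, ← ofReal_add]
      congr 3
      rw [phaseX, Real.sin_sq θ₁, Real.sin_sq θ₂]
      ring
    rw [hphase, hX, neg_add]
    linear_combination inner ℂ (φ.toLp 2 volume : H) (D (z.1 + α) (z.2 + β) (ψ.toLp 2 volume)) *
      (fracDensity θ₁ 0 (-z.2) * exp (I * ((-(-z.2 * α) : ℝ) : ℂ)) * h2 +
        exp (I * ((1 / 4 * (β ^ 2 - α ^ 2) * Real.sin (2 * θ₂)
            + α * β * Real.sin θ₂ ^ 2 : ℝ) : ℂ)) *
        fracDensity θ₂ (α * Real.cos θ₂ - β * Real.sin θ₂) (z.1 + α) * h1)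
  have hne : exp (I * (phaseX α β θ₁ θ₂ : ℂ)) ≠ 0 := Complex.exp_ne_zero _
  constructor
  · exact (integrable_const_mul_iff hne.isUnit _).1 (hi.congr key)
  · rw [smul_apply, ContinuousLinearMap.comp_apply, inner_smul_right, D_toLp, he,
      integral_congr_ae key, integral_const_mul, Complex.exp_neg]
    simp only [Prod.fst_add, Prod.snd_add]
    field_simp

theorem IsBifractional.exists_of_zero {θ₁ θ₂ : ℝ} (hθ : Real.cos (θ₁ - θ₂) ≠ 0) {T : H →L[ℂ] H}
    (hT : IsBifractional 0 0 θ₁ θ₂ T) (α β : ℝ) : ∃ S, IsBifractional α β θ₁ θ₂ S := by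
  -- Cramer's rule for the linear map of `comp_D`, whose determinant is `cos(θ₁ - θ₂)`.
  have h := hT.comp_D ((-α * Real.sin θ₂ + β * Real.cos θ₁) / Real.cos (θ₁ - θ₂))
    ((-α * Real.cos θ₂ - β * Real.sin θ₁) / Real.cos (θ₁ - θ₂))
  have hα : -((-α * Real.cos θ₂ - β * Real.sin θ₁) / Real.cos (θ₁ - θ₂)) * Real.cos θ₁ -
      (-α * Real.sin θ₂ + β * Real.cos θ₁) / Real.cos (θ₁ - θ₂) * Real.sin θ₁ = α := by
    field_simp
    rw [Real.cos_sub]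
    ring
  have hβ : (-α * Real.sin θ₂ + β * Real.cos θ₁) / Real.cos (θ₁ - θ₂) * Real.cos θ₂ -
      (-α * Real.cos θ₂ - β * Real.sin θ₁) / Real.cos (θ₁ - θ₂) * Real.sin θ₂ = β := by
    field_simp
    rw [Real.cos_sub]
    ring
  rw [hα, hβ] at h
  exact ⟨_, h⟩

theorem isBifractional_U {α β θ₁ θ₂ : ℝ} (h : ∃ T, IsBifractional α β θ₁ θ₂ T) :
    IsBifractional α β θ₁ θ₂ (U α β θ₁ θ₂) := by
  rw [U, dif_pos h]
  exact h.choose_spec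

/-! ### Norm bounds for averages of displacement operators. -/

section Averages

variable {V : Type*} [NormedAddCommGroup V] [MeasurableSpace V] [BorelSpace V]
  [SecondCountableTopology V] {μ : Measure V} {L : V → ℝ × ℝ}

theorem integrable_smul_D (hL : Continuous L) (ψ : SchwartzMap ℝ ℂ) {f : V → ℂ}
    (hf : Integrable f μ) :
    Integrable (fun v => f v • D (L v).1 (L v).2 (ψ.toLp 2 volume)) μ := by
  refine (hf.norm.mul_const ‖(ψ.toLp 2 volume : H)‖).mono'
    (hf.1.smul ((continuous_D_toLp ψ).comp hL).aestronglyMeasurable)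
    (Eventually.of_forall fun v => ?_)
  rw [norm_smul, norm_D]

/-- The norm of an average `∫ f(v) D(L v) dv` of displacement operators is controlled by the
twisted autocorrelation of `f`. -/
theorem norm_sq_integral_smul_D_le [SFinite μ] [μ.IsAddLeftInvariant] (hL : Continuous L)
    (hadd : ∀ v u, L (v + u) = L v + L u) (ψ : SchwartzMap ℝ ℂ) {f : V → ℂ} (hf : Integrable f μ)
    {G : V → ℝ} (hG : Integrable G μ)
    (hfG : ∀ u, ‖∫ v, conj (f v) * f (v + u) *
      exp (I * (((L v).1 * (L u).2 - (L v).2 * (L u).1 : ℝ) : ℂ)) ∂μ‖ ≤ G u) :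
    ‖∫ v, f v • D (L v).1 (L v).2 (ψ.toLp 2 volume) ∂μ‖ ^ 2 ≤
      ‖(ψ.toLp 2 volume : H)‖ ^ 2 * ∫ u, G u ∂μ := by
  set Φ : V → H := fun v => f v • D (L v).1 (L v).2 (ψ.toLp 2 volume) with hΦ
  have hΦi : Integrable Φ μ := integrable_smul_D hL ψ hf
  have hprod : Integrable (fun p : V × V => (inner ℂ (Φ p.1) (Φ p.2) : ℂ)) (μ.prod μ) := by
    refine (hΦi.norm.mul_prod hΦi.norm).mono' (hΦi.1.comp_fst.inner hΦi.1.comp_snd)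
      (Eventually.of_forall fun p => norm_inner_le_norm _ _)
  have hprod' : Integrable (fun p : V × V => (inner ℂ (Φ p.1) (Φ (p.1 + p.2)) : ℂ)) (μ.prod μ) :=
    (measurePreserving_prod_add μ μ).integrable_comp_of_integrable hprod
  -- The double integral in `(v, w)` becomes one in `(v, u)` with `w = v + u`, by translation
  -- invariance.
  have e1 : (inner ℂ (∫ v, Φ v ∂μ) (∫ v, Φ v ∂μ) : ℂ) =
      ∫ u, ∫ v, inner ℂ (Φ v) (Φ (v + u)) ∂μ ∂μ := by
    rw [← integral_integral_swap hprod', ← inner_conj_symm, ← integral_inner hΦi,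
      ← integral_conj]
    refine integral_congr_ae (Eventually.of_forall fun v => ?_)
    simp only
    rw [inner_conj_symm, ← integral_inner hΦi,
      integral_add_left_eq_self (fun w => (inner ℂ (Φ v) (Φ w) : ℂ)) v]
  have e2 : ∀ u, ‖∫ v, inner ℂ (Φ v) (Φ (v + u)) ∂μ‖ ≤ ‖(ψ.toLp 2 volume : H)‖ ^ 2 * G u := by
    intro u
    -- The matrix element depends on `u` alone, so it leaves the `v`-integral, and what remains is
    -- the twisted autocorrelation.
    have e : ∀ v, (inner ℂ (Φ v) (Φ (v + u)) : ℂ) = conj (f v) * f (v + u) *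
        exp (I * (((L v).1 * (L u).2 - (L v).2 * (L u).1 : ℝ) : ℂ)) * matrixElement ψ ψ (L u) := by
      intro v
      rw [hΦ, inner_smul_left, inner_smul_right, inner_D_D, hadd, matrixElement]
      simp only [Prod.fst_add, Prod.snd_add, add_sub_cancel_left]
      rw [show (L v).1 * ((L v).2 + (L u).2) - (L v).2 * ((L v).1 + (L u).1) =
        (L v).1 * (L u).2 - (L v).2 * (L u).1 by ring]
      ring
    simp_rw [e]
    rw [integral_mul_const, norm_mul, mul_comm]
    have h1 := norm_matrixElement_le ψ ψ (L u)
    rw [← sq] at h1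
    exact mul_le_mul h1 (hfG u) (norm_nonneg _) (sq_nonneg _)
  have e3 : ‖∫ v, Φ v ∂μ‖ ^ 2 = ‖(inner ℂ (∫ v, Φ v ∂μ) (∫ v, Φ v ∂μ) : ℂ)‖ := by
    rw [inner_self_eq_norm_sq_to_K]
    simp
  rw [e3, e1, ← integral_const_mul]
  exact norm_integral_le_of_norm_le (hG.const_mul _) (Eventually.of_forall e2)

end Averages

/-! ### From bounded weak integrals to operators. -/

/-- A sesquilinear form on Schwartz functions that is bounded in the `L²` norm is given by a
bounded operator. -/
theorem exists_clm_of_bound (B : SchwartzMap ℝ ℂ →ₗ⋆[ℂ] SchwartzMap ℝ ℂ →ₗ[ℂ] ℂ) (C : ℝ)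
    (hC : ∀ φ ψ, ‖B φ ψ‖ ≤ C * ‖(φ.toLp 2 volume : H)‖ * ‖(ψ.toLp 2 volume : H)‖) :
    ∃ T : H →L[ℂ] H, ∀ φ ψ : SchwartzMap ℝ ℂ,
      inner ℂ (φ.toLp 2 volume : H) (T (ψ.toLp 2 volume)) = B φ ψ := by
  set e : SchwartzMap ℝ ℂ →ₗ[ℂ] H := (SchwartzMap.toLpCLM ℂ ℂ 2 volume).toLinearMap with he
  have hd : DenseRange e := denseRange_schwartz_toLp
  have hw : ∀ φ, ∃ w : H, (∀ ψ, inner ℂ w (e ψ) = B φ ψ) ∧ ‖w‖ ≤ |C| * ‖e φ‖ := by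
    intro φ
    have hb : ∀ ψ, ‖B φ ψ‖ ≤ |C| * ‖e φ‖ * ‖e ψ‖ := fun ψ => (hC φ ψ).trans (by
      gcongr
      exacts [le_abs_self C, le_rfl, le_rfl])
    -- Riesz representation of `B φ`, after extending it from the dense Schwartz space.
    refine ⟨(InnerProductSpace.toDual ℂ H).symm ((B φ).extendOfNorm e), fun ψ => ?_, ?_⟩
    · rw [InnerProductSpace.toDual_symm_apply, LinearMap.extendOfNorm_eq hd ⟨_, hb⟩]
    · rw [LinearIsometryEquiv.norm_map]
      exact LinearMap.opNorm_extendOfNorm_le hd (by positivity) hb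
  choose w hwB hwn using hw
  have hext : ∀ {x y : H}, (∀ ψ, (inner ℂ x (e ψ) : ℂ) = inner ℂ y (e ψ)) → x = y := by
    intro x y h
    refine ext_inner_schwartz fun φ => ?_
    rw [← inner_conj_symm, ← inner_conj_symm _ y]
    exact congrArg conj (h φ)
  let W : SchwartzMap ℝ ℂ →ₗ[ℂ] H :=
    { toFun := w
      map_add' := fun φ φ' => hext fun ψ => by simp [inner_add_left, hwB]
      map_smul' := fun c φ => hext fun ψ => by simp [inner_smul_left, hwB] }
  -- `W` represents the form through its first slot, so the operator sought is the adjoint of its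
  -- extension.
  refine ⟨(W.extendOfNorm e).adjoint, fun φ ψ => ?_⟩
  rw [ContinuousLinearMap.adjoint_inner_right]
  have h := LinearMap.extendOfNorm_eq (f := W) hd ⟨|C|, hwn⟩ φ
  exact (congrArg (fun x : H => (inner ℂ x (e ψ) : ℂ)) h).trans (hwB φ ψ)

theorem exists_weak_integral {V : Type*} [MeasurableSpace V] {μ : Measure V} {L : V → ℝ × ℝ}
    (F : V → ℂ) (C : ℝ)
    (hF : ∀ φ ψ, Integrable (fun v => F v * matrixElement φ ψ (L v)) μ)
    (hC : ∀ φ ψ : SchwartzMap ℝ ℂ, ‖∫ v, F v * matrixElement φ ψ (L v) ∂μ‖ ≤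
      C * ‖(φ.toLp 2 volume : H)‖ * ‖(ψ.toLp 2 volume : H)‖) :
    ∃ T : H →L[ℂ] H, ∀ φ ψ : SchwartzMap ℝ ℂ,
      inner ℂ (φ.toLp 2 volume : H) (T (ψ.toLp 2 volume)) =
        ∫ v, F v * matrixElement φ ψ (L v) ∂μ := by
  have toLp_add : ∀ φ φ' : SchwartzMap ℝ ℂ,
      ((φ + φ').toLp 2 volume : H) = φ.toLp 2 volume + φ'.toLp 2 volume :=
    map_add (SchwartzMap.toLpCLM ℂ ℂ 2 volume)
  have toLp_smul : ∀ (c : ℂ) (φ : SchwartzMap ℝ ℂ),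
      ((c • φ).toLp 2 volume : H) = c • φ.toLp 2 volume :=
    map_smul (SchwartzMap.toLpCLM ℂ ℂ 2 volume)
  refine exists_clm_of_bound
    (LinearMap.mk₂'ₛₗ _ _ (fun φ ψ => ∫ v, F v * matrixElement φ ψ (L v) ∂μ) ?_ ?_ ?_ ?_) C hC
  · intro φ φ' ψ
    rw [← integral_add (hF φ ψ) (hF φ' ψ)]
    simp only [matrixElement, toLp_add, inner_add_left, mul_add]
  · intro c φ ψ
    simp only [matrixElement, toLp_smul, inner_smul_left, smul_eq_mul, mul_left_comm _ (conj c),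
      integral_const_mul]
  · intro φ ψ ψ'
    rw [← integral_add (hF φ ψ) (hF φ ψ')]
    simp only [matrixElement, toLp_add, map_add, inner_add_right, mul_add]
  · intro c φ ψ
    simp only [matrixElement, toLp_smul, map_smul, inner_smul_right, smul_eq_mul,
      mul_left_comm _ c, integral_const_mul, RingHom.id_apply]

/-- The weak integral `∫ F(v) D(L v) dv` defines a bounded operator as soon as `F` is a pointwise
limit of dominated integrable functions with uniformly bounded twisted autocorrelations. -/
theorem exists_weak_integral_of_approx {V : Type*} [NormedAddCommGroup V] [MeasurableSpace V]
    [BorelSpace V] [SecondCountableTopology V] {μ : Measure V} [SFinite μ] [μ.IsAddLeftInvariant]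
    {L : V → ℝ × ℝ} (hL : Continuous L)
    (hadd : ∀ v u, L (v + u) = L v + L u) {F : V → ℂ} {f : ℕ → V → ℂ} {G : ℕ → V → ℝ} {C : ℝ}
    (hF : ∀ φ ψ, Integrable (fun v => F v * matrixElement φ ψ (L v)) μ)
    (hf : ∀ n, Integrable (f n) μ) (hfF : ∀ n v, ‖f n v‖ ≤ ‖F v‖)
    (hlim : ∀ v, Tendsto (fun n => f n v) atTop (𝓝 (F v)))
    (hG : ∀ n, Integrable (G n) μ)
    (hfG : ∀ n u, ‖∫ v, conj (f n v) * f n (v + u) *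
      exp (I * (((L v).1 * (L u).2 - (L v).2 * (L u).1 : ℝ) : ℂ)) ∂μ‖ ≤ G n u)
    (hGC : ∀ n, ∫ u, G n u ∂μ ≤ C) :
    ∃ T : H →L[ℂ] H, ∀ φ ψ : SchwartzMap ℝ ℂ,
      inner ℂ (φ.toLp 2 volume : H) (T (ψ.toLp 2 volume)) =
        ∫ v, F v * matrixElement φ ψ (L v) ∂μ := by
  refine exists_weak_integral F √C hF fun φ ψ => ?_
  have ht : Tendsto (fun n => ∫ v, f n v * matrixElement φ ψ (L v) ∂μ) atTop
      (𝓝 (∫ v, F v * matrixElement φ ψ (L v) ∂μ)) := by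
    refine tendsto_integral_of_dominated_convergence
      (fun v => ‖F v * matrixElement φ ψ (L v)‖) (fun n => ?_) (hF φ ψ).norm (fun n => ?_) ?_
    · exact (hf n).1.mul ((continuous_matrixElement φ ψ).comp hL).aestronglyMeasurable
    · refine Eventually.of_forall fun v => ?_
      rw [norm_mul, norm_mul]
      gcongr
      exact hfF n v
    · exact Eventually.of_forall fun v => (hlim v).mul_const _
  refine le_of_tendsto ht.norm (Eventually.of_forall fun n => ?_)
  have e : ∫ v, f n v * matrixElement φ ψ (L v) ∂μ = inner ℂ (φ.toLp 2 volume : H)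
      (∫ v, f n v • D (L v).1 (L v).2 (ψ.toLp 2 volume) ∂μ) := by
    rw [← integral_inner (integrable_smul_D hL ψ (hf n))]
    simp only [inner_smul_right, matrixElement]
  rw [e, mul_comm √C, mul_assoc]
  refine (norm_inner_le_norm _ _).trans (mul_le_mul_of_nonneg_left ?_ (norm_nonneg _))
  have h := norm_sq_integral_smul_D_le hL hadd ψ (hf n) (hG n) (hfG n)
  have h' := h.trans (mul_le_mul_of_nonneg_left (hGC n) (sq_nonneg _))
  have h2 := Real.sqrt_le_sqrt h'
  rwa [Real.sqrt_sq (norm_nonneg _), Real.sqrt_mul (sq_nonneg _), Real.sqrt_sq (norm_nonneg _),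
    mul_comm] at h2

/-! ### Gaussian estimates for damped chirps. -/

/-- The damped chirp `exp(-(r + i s) x²)`. -/
def dampedChirp (r s x : ℝ) : ℂ := exp (-(r + s * I) * x ^ 2)

theorem norm_dampedChirp (r s x : ℝ) : ‖dampedChirp r s x‖ = Real.exp (-r * x ^ 2) := by
  rw [dampedChirp, norm_exp]
  congr 1
  rw [← ofReal_pow, re_mul_ofReal]
  simp

@[fun_prop]
theorem continuous_dampedChirp (r s : ℝ) : Continuous (dampedChirp r s) := by
  unfold dampedChirp
  fun_prop

theorem integrable_dampedChirp {r : ℝ} (hr : 0 < r) (s : ℝ) : Integrable (dampedChirp r s) :=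
  (integrable_exp_neg_mul_sq hr).mono' (continuous_dampedChirp r s).aestronglyMeasurable
    (Eventually.of_forall fun x => (norm_dampedChirp r s x).le)

theorem norm_dampedChirp_le {r : ℝ} (hr : 0 ≤ r) (s x : ℝ) :
    ‖dampedChirp r s x‖ ≤ ‖dampedChirp 0 s x‖ := by
  rw [norm_dampedChirp, norm_dampedChirp]
  gcongr

theorem tendsto_dampedChirp (s x : ℝ) :
    Tendsto (fun n : ℕ => dampedChirp (1 / ((n : ℝ) + 1)) s x) atTop (𝓝 (dampedChirp 0 s x)) := by
  have h : Continuous fun r : ℝ => dampedChirp r s x := by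
    unfold dampedChirp
    fun_prop
  exact (h.tendsto 0).comp tendsto_one_div_add_atTop_nhds_zero_nat

/-- The integrand is a Gaussian with quadratic coefficient `-2r`, since the chirps cancel to a
linear phase. The exact modulus has a further factor `exp(-r u²/2)`, dropped here. The height grows
like `r^{-1/2}` while the width in `2su - v` shrinks like `r^{1/2}`, which is what makes later `L¹`
bounds uniform in `r`. -/
theorem norm_integral_dampedChirp_le {r : ℝ} (hr : 0 < r) (s u v : ℝ) :
    ‖∫ x, conj (dampedChirp r s x) * dampedChirp r s (x + u) * exp (I * ((x * v : ℝ) : ℂ))‖ ≤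
      √(Real.pi / (2 * r)) * Real.exp (-(8 * r)⁻¹ * (2 * s * u - v) ^ 2) := by
  have e : ∀ x : ℝ, conj (dampedChirp r s x) * dampedChirp r s (x + u) *
      exp (I * ((x * v : ℝ) : ℂ)) = exp (((-2 * r : ℝ) : ℂ) * x ^ 2 +
        (-2 * (r + s * I) * u + v * I) * x + -(r + s * I) * u ^ 2) := by
    intro x
    rw [dampedChirp, dampedChirp, ← exp_conj, ← Complex.exp_add, ← Complex.exp_add]
    congr 1
    simp only [map_mul, map_neg, map_add, map_pow, conj_ofReal, conj_I]
    push_cast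
    ring
  simp_rw [e]
  have hb : (((-2 * r : ℝ) : ℂ)).re < 0 := by
    rw [ofReal_re]
    linarith
  rw [integral_cexp_quadratic hb, norm_mul]
  have h1 : (Real.pi / -((-2 * r : ℝ) : ℂ)) = ((Real.pi / (2 * r) : ℝ) : ℂ) := by
    push_cast
    ring
  rw [h1, norm_cpow_eq_rpow_re_of_pos (by positivity), norm_exp, Real.sqrt_eq_rpow]
  have h2 : ((1 : ℂ) / 2).re = 1 / 2 := by norm_num
  rw [h2]
  gcongr
  have h3 : -(r + s * I) * (u : ℂ) ^ 2 -
      (-2 * (r + s * I) * u + v * I) ^ 2 / (4 * ((-2 * r : ℝ) : ℂ)) =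
      ((-(r / 2 * u ^ 2) + -(8 * r)⁻¹ * (2 * s * u - v) ^ 2 : ℝ) : ℂ) +
        ((-(v * u) / 2 : ℝ) : ℂ) * I := by
    have : (r : ℂ) ≠ 0 := ofReal_ne_zero.2 hr.ne'
    push_cast
    field_simp
    ring_nf
    simp only [I_sq]
    ring
  rw [h3, add_re, ofReal_re, re_ofReal_mul, I_re, mul_zero, add_zero]
  have : 0 ≤ r / 2 * u ^ 2 := by positivity
  linarith

/-- The weak integral of displacement operators along a line against a chirp. -/
theorem exists_weak_integral_line {s : ℝ} (hs : s ≠ 0) (p q : ℝ)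
    (hint : ∀ φ ψ : SchwartzMap ℝ ℂ, Integrable fun t : ℝ => matrixElement φ ψ (p * t, q * t)) :
    ∃ T : H →L[ℂ] H, ∀ φ ψ : SchwartzMap ℝ ℂ,
      inner ℂ (φ.toLp 2 volume : H) (T (ψ.toLp 2 volume)) =
        ∫ t : ℝ, dampedChirp 0 s t * matrixElement φ ψ (p * t, q * t) := by
  have hr : ∀ n : ℕ, (0 : ℝ) < 1 / ((n : ℝ) + 1) := fun n => by positivity
  refine exists_weak_integral_of_approx (L := fun t : ℝ => (p * t, q * t)) (by fun_prop)
    (fun v u => by simp [mul_add]) (f := fun n => dampedChirp (1 / ((n : ℝ) + 1)) s)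
    (G := fun n u => √(Real.pi / (2 * (1 / ((n : ℝ) + 1)))) *
      Real.exp (-(s ^ 2 / (2 * (1 / ((n : ℝ) + 1)))) * u ^ 2)) (C := √(Real.pi ^ 2 / s ^ 2))
    (fun φ ψ => ?_) (fun n => integrable_dampedChirp (hr n) s)
    (fun n v => norm_dampedChirp_le (hr n).le s v) (tendsto_dampedChirp s) (fun n => ?_)
    (fun n u => ?_) (fun n => ?_)
  · exact (hint φ ψ).bdd_mul (c := 1) (continuous_dampedChirp 0 s).aestronglyMeasurable
      (Eventually.of_forall fun x => by simp [norm_dampedChirp])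
  · exact (integrable_exp_neg_mul_sq (by have := hr n; positivity)).const_mul _
  -- The symplectic form vanishes on a line, so the twist is trivial (`v = 0`) and `s ≠ 0` alone
  -- makes the bound integrable in `u`.
  · have h := norm_integral_dampedChirp_le (hr n) s u 0
    have e : ∀ v : ℝ, p * v * (q * u) - q * v * (p * u) = v * 0 := fun v => by ring
    simp only [e]
    refine h.trans_eq ?_
    congr 2
    have := (hr n).ne'
    field_simp
    ring
  · have := hr n
    rw [integral_const_mul, integral_gaussian, ← Real.sqrt_mul (by positivity)]
    refine le_of_eq (congrArg _ ?_)
    field_simp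

/-- The linear map `(u, v) ↦ (a u - v, u + b v)` and Gaussian integrals. -/
theorem integral_gaussian_linear {a b : ℝ} (hab : a * b + 1 ≠ 0) {k : ℝ} (hk : 0 < k) :
    Integrable (fun z : ℝ × ℝ => Real.exp (-k * (a * z.1 - z.2) ^ 2) *
      Real.exp (-k * (b * z.2 + z.1) ^ 2)) ∧
    ∫ z : ℝ × ℝ, Real.exp (-k * (a * z.1 - z.2) ^ 2) * Real.exp (-k * (b * z.2 + z.1) ^ 2) =
      |a * b + 1|⁻¹ * (Real.pi / k) := by
  set A : ℝ × ℝ →ₗ[ℝ] ℝ × ℝ := Matrix.toLin (Module.Basis.finTwoProd ℝ) (Module.Basis.finTwoProd ℝ)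
    !![a, -1; 1, b] with hA
  have hdet : LinearMap.det A = a * b + 1 := by
    rw [hA, LinearMap.det_toLin, Matrix.det_fin_two_of]
    ring
  have hdet0 : LinearMap.det A ≠ 0 := hdet ▸ hab
  have hmap := Measure.map_linearMap_addHaar_eq_smul_addHaar (volume : Measure (ℝ × ℝ)) hdet0
  have hAc : Continuous A := A.continuous_of_finiteDimensional
  have e : (fun z : ℝ × ℝ => Real.exp (-k * (a * z.1 - z.2) ^ 2) *
      Real.exp (-k * (b * z.2 + z.1) ^ 2)) =
      (fun w : ℝ × ℝ => Real.exp (-k * w.1 ^ 2) * Real.exp (-k * w.2 ^ 2)) ∘ A := by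
    funext z
    simp only [Function.comp, hA, Matrix.toLin_finTwoProd_apply]
    ring_nf
  have hi : Integrable fun w : ℝ × ℝ => Real.exp (-k * w.1 ^ 2) * Real.exp (-k * w.2 ^ 2) :=
    (integrable_exp_neg_mul_sq hk).mul_prod (integrable_exp_neg_mul_sq hk)
  have hi' : Integrable (fun w : ℝ × ℝ => Real.exp (-k * w.1 ^ 2) * Real.exp (-k * w.2 ^ 2))
      (Measure.map A volume) := by
    rw [hmap]
    exact hi.smul_measure ENNReal.ofReal_ne_top
  constructor
  · rw [e]
    exact hi'.comp_aemeasurable hAc.aemeasurable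
  · rw [e]
    have h := integral_map hAc.aemeasurable hi'.1
    refine h.symm.trans ?_
    rw [hmap, integral_smul_measure, Measure.volume_eq_prod,
      integral_prod_mul (fun x : ℝ => Real.exp (-k * x ^ 2)) (fun x : ℝ => Real.exp (-k * x ^ 2)),
      integral_gaussian, Real.mul_self_sqrt (by positivity), hdet, abs_inv,
      ENNReal.toReal_ofReal (by positivity), smul_eq_mul]

/-- The weak integral of displacement operators over the phase plane against a product of
chirps. -/
theorem exists_weak_integral_plane {s t : ℝ} (hst : 2 * s * (2 * t) + 1 ≠ 0) :
    ∃ T : H →L[ℂ] H, ∀ φ ψ : SchwartzMap ℝ ℂ,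
      inner ℂ (φ.toLp 2 volume : H) (T (ψ.toLp 2 volume)) =
        ∫ z : ℝ × ℝ, dampedChirp 0 s z.1 * dampedChirp 0 t z.2 * matrixElement φ ψ z := by
  have hr : ∀ n : ℕ, (0 : ℝ) < 1 / ((n : ℝ) + 1) := fun n => by positivity
  refine exists_weak_integral_of_approx (L := fun z : ℝ × ℝ => z) continuous_id
    (fun v u => rfl)
    (f := fun n z => dampedChirp (1 / ((n : ℝ) + 1)) s z.1 * dampedChirp (1 / ((n : ℝ) + 1)) t z.2)
    (G := fun n u => Real.pi / (2 * (1 / ((n : ℝ) + 1))) *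
      (Real.exp (-(8 * (1 / ((n : ℝ) + 1)))⁻¹ * (2 * s * u.1 - u.2) ^ 2) *
        Real.exp (-(8 * (1 / ((n : ℝ) + 1)))⁻¹ * (2 * t * u.2 + u.1) ^ 2)))
    (C := |2 * s * (2 * t) + 1|⁻¹ * (4 * Real.pi ^ 2))
    (fun φ ψ => ?_) (fun n => ?_) (fun n v => ?_) (fun v => ?_) (fun n => ?_)
    (fun n u => ?_) (fun n => ?_)
  · exact (integrable_matrixElement φ ψ).bdd_mul (c := 1)
      (by fun_prop : Continuous fun z : ℝ × ℝ =>
        dampedChirp 0 s z.1 * dampedChirp 0 t z.2).aestronglyMeasurable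
      (Eventually.of_forall fun x => by simp [norm_dampedChirp])
  · exact (integrable_dampedChirp (hr n) s).mul_prod (integrable_dampedChirp (hr n) t)
  · rw [norm_mul, norm_mul]
    gcongr
    exacts [norm_dampedChirp_le (hr n).le s v.1, norm_dampedChirp_le (hr n).le t v.2]
  · exact (tendsto_dampedChirp s v.1).mul (tendsto_dampedChirp t v.2)
  · exact (integral_gaussian_linear hst (inv_pos.2 (mul_pos (by norm_num) (hr n)))).1.const_mul _
  -- The twist `v₁u₂ - v₂u₁` separates, so the autocorrelation is a product of two one-dimensional
  -- ones with frequencies `u₂` and `-u₁`.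
  · have h1 := norm_integral_dampedChirp_le (hr n) s u.1 u.2
    have h2 := norm_integral_dampedChirp_le (hr n) t u.2 (-u.1)
    rw [sub_neg_eq_add] at h2
    have hrn := hr n
    generalize 1 / ((n : ℝ) + 1) = r at h1 h2 hrn ⊢
    have e : ∀ v : ℝ × ℝ, conj (dampedChirp r s v.1 * dampedChirp r t v.2) *
        (dampedChirp r s (v + u).1 * dampedChirp r t (v + u).2) *
        exp (I * ((v.1 * u.2 - v.2 * u.1 : ℝ) : ℂ)) =
        (conj (dampedChirp r s v.1) * dampedChirp r s (v.1 + u.1) *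
          exp (I * ((v.1 * u.2 : ℝ) : ℂ))) *
        (conj (dampedChirp r t v.2) * dampedChirp r t (v.2 + u.2) *
          exp (I * ((v.2 * -u.1 : ℝ) : ℂ))) := by
      intro v
      have hx : exp (I * ((v.1 * u.2 - v.2 * u.1 : ℝ) : ℂ)) =
          exp (I * ((v.1 * u.2 : ℝ) : ℂ)) * exp (I * ((v.2 * -u.1 : ℝ) : ℂ)) := by
        rw [← Complex.exp_add]
        congr 1
        push_cast
        ring
      rw [hx, map_mul, Prod.fst_add, Prod.snd_add]
      ring
    simp_rw [e]
    rw [Measure.volume_eq_prod, integral_prod_mul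
      (fun x : ℝ => conj (dampedChirp r s x) * dampedChirp r s (x + u.1) *
          exp (I * ((x * u.2 : ℝ) : ℂ)))
      (fun x : ℝ => conj (dampedChirp r t x) * dampedChirp r t (x + u.2) *
          exp (I * ((x * -u.1 : ℝ) : ℂ))), norm_mul]
    refine (mul_le_mul h1 h2 (norm_nonneg _) (by positivity)).trans_eq ?_
    rw [mul_mul_mul_comm, Real.mul_self_sqrt (by positivity)]
  -- The damping cancels: `π/(2r)` times `8πr` is `4π²`.
  · have := hr n
    rw [integral_const_mul,
      (integral_gaussian_linear hst (inv_pos.2 (mul_pos (by norm_num) (hr n)))).2]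
    refine le_of_eq ?_
    field_simp
    norm_num

/-! ### Existence of the operator at the origin. -/

theorem fracDensity_zero_eq {θ : ℝ} (h : Real.sin θ ≠ 0) (y : ℝ) :
    fracDensity θ 0 y = ((1 + I * (Real.cot θ : ℂ)) / (2 * Real.pi)) ^ (1 / 2 : ℂ) *
      dampedChirp 0 (Real.cot θ / 2) y := by
  rw [fracDensity, if_neg h, dampedChirp]
  congr 2
  push_cast
  ring

theorem fracDensity_of_sin_eq_zero {θ : ℝ} (h : Real.sin θ = 0) (x y : ℝ) :
    fracDensity θ x y = 1 := if_pos h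

theorem continuous_fracDensity (θ x : ℝ) : Continuous (fracDensity θ x) := by
  unfold fracDensity
  split_ifs <;> fun_prop

theorem dampedChirp_neg (r s x : ℝ) : dampedChirp r s (-x) = dampedChirp r s x := by
  simp [dampedChirp]

/-- If the measure of the weak integral is parametrized by `L`, a weak integral along `L` gives the
bifractional displacement operator. -/
theorem exists_isBifractional_zero {V : Type*} [TopologicalSpace V] [MeasurableSpace V]
    [OpensMeasurableSpace V] {μ : Measure V} {L : V → ℝ × ℝ} (hL : Continuous L) {θ₁ θ₂ : ℝ}
    (hμ : bifracMeasure 0 0 θ₁ θ₂ = μ.map L) {F : V → ℂ} (K : ℂ)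
    (hF : ∀ v, fracDensity θ₂ 0 (L v).1 * fracDensity θ₁ 0 (-(L v).2) = K * F v)
    (hint : ∀ φ ψ, Integrable (fun v => F v * matrixElement φ ψ (L v)) μ)
    (hT : ∃ T : H →L[ℂ] H, ∀ φ ψ : SchwartzMap ℝ ℂ,
      inner ℂ (φ.toLp 2 volume : H) (T (ψ.toLp 2 volume)) =
        ∫ v, F v * matrixElement φ ψ (L v) ∂μ) :
    ∃ T, IsBifractional 0 0 θ₁ θ₂ T := by
  obtain ⟨T, hT⟩ := hT
  refine ⟨(((|Real.cos (θ₁ - θ₂)| ^ (1 / 2 : ℝ) : ℝ) : ℂ) * K) • T, fun φ ψ => ?_⟩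
  have hc : Continuous fun z : ℝ × ℝ => fracDensity θ₂ 0 z.1 * fracDensity θ₁ 0 (-z.2) *
      matrixElement φ ψ z := by
    have h1 := continuous_fracDensity θ₁ 0
    have h2 := continuous_fracDensity θ₂ 0
    have h3 := continuous_matrixElement φ ψ
    fun_prop
  change Integrable (fun z : ℝ × ℝ => fracDensity θ₂ 0 z.1 * fracDensity θ₁ 0 (-z.2) *
      matrixElement φ ψ z) _ ∧ _ = _ * ∫ z : ℝ × ℝ, fracDensity θ₂ 0 z.1 *
        fracDensity θ₁ 0 (-z.2) * matrixElement φ ψ z ∂_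
  rw [hμ, integrable_map_measure hc.aestronglyMeasurable hL.aemeasurable,
    integral_map hL.aemeasurable hc.aestronglyMeasurable]
  simp only [Function.comp_def, hF, mul_assoc K, integral_const_mul]
  refine ⟨(hint φ ψ).const_mul K, ?_⟩
  rw [smul_apply, inner_smul_right, hT, mul_assoc]

theorem map_neg_fracMeasure_zero (θ : ℝ) :
    (fracMeasure θ 0).map (fun y => -y) = fracMeasure θ 0 := by
  unfold fracMeasure
  split_ifs
  · rw [Measure.map_dirac' (by fun_prop), zero_mul, neg_zero]
  · exact Measure.map_neg_eq_self volume

theorem cot_ne_zero_of_cos_sub_ne_zero {θ θ' : ℝ} (h : Real.cos (θ - θ') ≠ 0)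
    (h0 : Real.sin θ ≠ 0) (h0' : Real.sin θ' = 0) : Real.cot θ / 2 ≠ 0 := by
  rw [Real.cos_sub, h0', mul_zero, add_zero] at h
  rw [Real.cot_eq_cos_div_sin]
  exact div_ne_zero (div_ne_zero (left_ne_zero_of_mul h) h0) two_ne_zero

/-- Each vanishing sine collapses one integration variable to `0`, leaving the identity operator, a
line or the whole plane. The nondegeneracy condition is `cot θ ≠ 0` on a line and `1 + cot θ₁ cot θ₂
≠ 0` on the plane; both follow from `cos(θ₁ - θ₂) ≠ 0`. -/
theorem exists_isBifractional_zero_zero {θ₁ θ₂ : ℝ} (hθ : Real.cos (θ₁ - θ₂) ≠ 0) :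
    ∃ T, IsBifractional 0 0 θ₁ θ₂ T := by
  have hμ : bifracMeasure 0 0 θ₁ θ₂ = (fracMeasure θ₂ 0).prod (fracMeasure θ₁ 0) := by
    rw [bifracMeasure, map_neg_fracMeasure_zero]
  by_cases h₂ : Real.sin θ₂ = 0 <;> by_cases h₁ : Real.sin θ₁ = 0
  · rw [fracMeasure, fracMeasure, if_pos h₂, if_pos h₁, zero_mul, zero_mul,
      Measure.dirac_prod_dirac] at hμ
    refine exists_isBifractional_zero (μ := Measure.dirac (0 : ℝ × ℝ)) continuous_id
      (F := fun _ => 1) (by rw [hμ, Measure.map_id]; rfl) 1 (fun v => ?_) (fun φ ψ => ?_)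
      ⟨ContinuousLinearMap.id ℂ H, fun φ ψ => ?_⟩
    · rw [fracDensity_of_sin_eq_zero h₂, fracDensity_of_sin_eq_zero h₁]
    · exact integrable_dirac (by finiteness)
    · rw [integral_dirac, one_mul, id, matrixElement, Prod.fst_zero, Prod.snd_zero, D_zero]
  · rw [fracMeasure, fracMeasure, if_pos h₂, if_neg h₁, zero_mul, Measure.dirac_prod] at hμ
    have hi : ∀ φ ψ : SchwartzMap ℝ ℂ,
        Integrable fun t : ℝ => matrixElement φ ψ (0 * t, 1 * t) := fun φ ψ => by
      simpa using integrable_matrixElement_snd φ ψ 0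
    refine exists_isBifractional_zero (L := fun t : ℝ => (0 * t, 1 * t)) (by fun_prop)
      (by simpa using hμ) 
      (((1 + I * (Real.cot θ₁ : ℂ)) / (2 * Real.pi)) ^ (1 / 2 : ℂ)) (fun v => ?_) (fun φ ψ => ?_)
      (exists_weak_integral_line (cot_ne_zero_of_cos_sub_ne_zero hθ h₁ h₂) 0 1 hi)
    · rw [fracDensity_of_sin_eq_zero h₂, fracDensity_zero_eq h₁, one_mul, dampedChirp_neg, one_mul]
    · exact (hi φ ψ).bdd_mul (c := 1) (continuous_dampedChirp _ _).aestronglyMeasurable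
        (Eventually.of_forall fun x => by simp [norm_dampedChirp])
  · rw [fracMeasure, fracMeasure, if_neg h₂, if_pos h₁, zero_mul, Measure.prod_dirac] at hμ
    have hi : ∀ φ ψ : SchwartzMap ℝ ℂ,
        Integrable fun t : ℝ => matrixElement φ ψ (1 * t, 0 * t) := fun φ ψ => by
      simpa using integrable_matrixElement_fst φ ψ 0
    have hθ' : Real.cos (θ₂ - θ₁) ≠ 0 := by rwa [← Real.cos_neg, neg_sub]
    refine exists_isBifractional_zero (L := fun t : ℝ => (1 * t, 0 * t)) (by fun_prop)
      (by simpa using hμ) 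
      (((1 + I * (Real.cot θ₂ : ℂ)) / (2 * Real.pi)) ^ (1 / 2 : ℂ)) (fun v => ?_) (fun φ ψ => ?_)
      (exists_weak_integral_line (cot_ne_zero_of_cos_sub_ne_zero hθ' h₂ h₁) 1 0 hi)
    · rw [fracDensity_of_sin_eq_zero h₁, fracDensity_zero_eq h₂, one_mul, mul_one]
    · exact (hi φ ψ).bdd_mul (c := 1) (continuous_dampedChirp _ _).aestronglyMeasurable
        (Eventually.of_forall fun x => by simp [norm_dampedChirp])
  · rw [fracMeasure, fracMeasure, if_neg h₂, if_neg h₁, ← Measure.volume_eq_prod] at hμ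
    have hst : 2 * (Real.cot θ₂ / 2) * (2 * (Real.cot θ₁ / 2)) + 1 ≠ 0 := by
      have e : 2 * (Real.cot θ₂ / 2) * (2 * (Real.cot θ₁ / 2)) + 1 =
          Real.cos (θ₁ - θ₂) / (Real.sin θ₁ * Real.sin θ₂) := by
        rw [Real.cot_eq_cos_div_sin, Real.cot_eq_cos_div_sin, Real.cos_sub]
        field_simp
      rw [e]
      exact div_ne_zero hθ (mul_ne_zero h₁ h₂)
    refine exists_isBifractional_zero (L := fun z : ℝ × ℝ => z) continuous_id
      (by rw [hμ]; exact Measure.map_id.symm)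
      (((1 + I * (Real.cot θ₂ : ℂ)) / (2 * Real.pi)) ^ (1 / 2 : ℂ) *
        ((1 + I * (Real.cot θ₁ : ℂ)) / (2 * Real.pi)) ^ (1 / 2 : ℂ))
      (fun v => ?_) (fun φ ψ => ?_) (exists_weak_integral_plane hst)
    · rw [fracDensity_zero_eq h₂, fracDensity_zero_eq h₁, dampedChirp_neg]
      ring
    · exact (integrable_matrixElement φ ψ).bdd_mul (c := 1)
        (by fun_prop : Continuous fun z : ℝ × ℝ => dampedChirp 0 (Real.cot θ₂ / 2) z.1 *
          dampedChirp 0 (Real.cot θ₁ / 2) z.2).aestronglyMeasurable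
        (Eventually.of_forall fun x => by simp [norm_dampedChirp])

end Bifractional

end

theorem mainTheorem9 (θ₁ θ₂ : ℝ) (hθ : Real.cos (θ₁ - θ₂) ≠ 0) :
    -- the operators `U(α, β; θ₁, θ₂)` are well defined
    (∀ α β : ℝ, Bifractional.IsBifractional α β θ₁ θ₂ (Bifractional.U α β θ₁ θ₂) ∧
      ∀ T : Bifractional.H →L[ℂ] Bifractional.H,
        Bifractional.IsBifractional α β θ₁ θ₂ T → T = Bifractional.U α β θ₁ θ₂) ∧
    ∀ α β : ℝ,
      -- the operator identity
      Bifractional.U 0 0 θ₁ θ₂ ∘L Bifractional.D α β =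
        Complex.exp (Complex.I * (Bifractional.phaseX α β θ₁ θ₂ : ℂ)) •
          Bifractional.U (-β * Real.cos θ₁ - α * Real.sin θ₁)
            (α * Real.cos θ₂ - β * Real.sin θ₂) θ₁ θ₂ ∧
      -- the relation between the coherent states
      Bifractional.bifracCoherentR α β θ₁ θ₂ =
        Complex.exp (Complex.I * (Bifractional.phaseX α β θ₁ θ₂ : ℂ)) •
          Bifractional.bifracCoherent (-β * Real.cos θ₁ - α * Real.sin θ₁)
            (α * Real.cos θ₂ - β * Real.sin θ₂) θ₁ θ₂ := by
  obtain ⟨T, hT⟩ := Bifractional.exists_isBifractional_zero_zero hθ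
  have hU : ∀ α β, Bifractional.IsBifractional α β θ₁ θ₂ (Bifractional.U α β θ₁ θ₂) :=
    fun α β => Bifractional.isBifractional_U (hT.exists_of_zero hθ α β)
  refine ⟨fun α β => ⟨hU α β, fun S hS => hS.unique (hU α β)⟩, fun α β => ?_⟩
  have key : Bifractional.U 0 0 θ₁ θ₂ ∘L Bifractional.D α β =
      Complex.exp (Complex.I * (Bifractional.phaseX α β θ₁ θ₂ : ℂ)) •
        Bifractional.U (-β * Real.cos θ₁ - α * Real.sin θ₁)
          (α * Real.cos θ₂ - β * Real.sin θ₂) θ₁ θ₂ := by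
    rw [← ((hU 0 0).comp_D α β).unique (hU _ _), smul_smul, ← Complex.exp_add, add_neg_cancel,
      Complex.exp_zero, one_smul]
  exact ⟨key, DFunLike.congr_fun key Bifractional.vacuum⟩
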